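/- Let $A$ be an abelian variety over $\mathbb C$, and let $\mathcal T$ be the set of all torsion translates of abelian subvarieties of $A$, that is, of all subsets $t + B$ of the group of points of $A$, where $B \subseteq A$ is an abelian subvariety and $t \in A$ is a torsion point. For $T \in \mathcal T$ set $\operatorname{ord}(T) = \min\{\operatorname{ord}(t) \mid t \in T_{\mathrm{tor}}\}$, where $T_{\mathrm{tor}}$ denotes the (nonempty) set of all torsion points of $A$ lying in $T$, and for a positive integer $m$ set $mT = \{mx \mid x \in T\}$. Then: (i) For every $T \in \mathcal T$ and every integer $m > 0$ one has $mT \in \mathcal T$ and $$\operatorname{ord}(mT) \le \operatorname{ord}(T) \le m \cdot \operatorname{ord}(mT).$$ (ii) For every point $p \in A$, the set $$\{\operatorname{ord}(T) \mid T \in \mathcal T \text{ and } mp \in T \text{ for some integer } m > 0\}$$ is bounded. -/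

import Mathlib

open CategoryTheory MonoidalCategory AlgebraicGeometry

namespace AbVar

/-- Schemes over `ℂ`. -/
abbrev SchC : Type 1 := Over (Spec (.of ℂ))

/-- A group scheme over `ℂ` is an abelian variety if it is proper and (geometrically) integral. -/
class IsAbelianVariety (A : SchC) [GrpObj A] : Prop where
  isProper : IsProper A.hom
  geometricallyIntegral : GeometricallyIntegral A.hom

/-- The group `A(ℂ)` of complex points of a group scheme `A` over `ℂ`, written additively;
a point is a morphism `Spec ℂ ⟶ A` over `ℂ` (the tensor unit of `SchC` is `Spec ℂ`). -/
abbrev Points (A : SchC) : Type := Additive (𝟙_ SchC ⟶ A)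

/-- The group law on `A(ℂ)` induced by the group scheme structure of the abelian variety `A`. -/
noncomputable instance Points.instAddCommGroup (A : SchC) [GrpObj A] [IsAbelianVariety A] :
    AddCommGroup (Points A) :=
  have : IsProper A.hom := IsAbelianVariety.isProper
  have : GeometricallyIntegral A.hom := IsAbelianVariety.geometricallyIntegral
  have : IsCommMonObj A := isCommMonObj_of_isProper_of_geometricallyIntegral A
  letI : CommGroup (𝟙_ SchC ⟶ A) := Hom.commGroup
  inferInstanceAs (AddCommGroup (Additive (𝟙_ SchC ⟶ A)))

/-- The map `B(ℂ) → A(ℂ)` induced by a morphism `i : B ⟶ A` over `ℂ`. -/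
noncomputable def Points.map {B A : SchC} (i : B ⟶ A) (b : Points B) : Points A :=
  Additive.ofMul (b.toMul ≫ i)

variable (A : SchC) [GrpObj A] [IsAbelianVariety A]

/-- `H ⊆ A(ℂ)` is (the set of complex points of) an abelian subvariety of `A`: the image of
`B(ℂ)` for an abelian variety `B` and a closed immersion `B ⟶ A` of group schemes over `ℂ`. -/
def IsAbelianSubvariety (H : Set (Points A)) : Prop :=
  ∃ (B : SchC) (_ : GrpObj B) (i : B ⟶ A),
    IsAbelianVariety B ∧ IsMonHom i ∧ IsClosedImmersion i.left ∧ H = Set.range (Points.map i)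

/-- The set of all torsion translates `t + H` of abelian subvarieties `H` of `A`. -/
def torsionTranslates : Set (Set (Points A)) :=
  {T | ∃ (H : Set (Points A)) (t : Points A),
    IsAbelianSubvariety A H ∧ IsOfFinAddOrder t ∧ T = (fun h => t + h) '' H}

variable {A}

/-- The image `mT = {m • x | x ∈ T}` of `T` under multiplication by `m`. -/
def mulImage (m : ℕ) (T : Set (Points A)) : Set (Points A) :=
  (fun x => m • x) '' T

/-- The minimal order of a torsion point in `T` (a minimum over a nonempty set of positive
integers whenever `T` is a torsion translate). -/
noncomputable def ord (T : Set (Points A)) : ℕ :=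
  sInf {n | ∃ t ∈ T, IsOfFinAddOrder t ∧ n = addOrderOf t}

end AbVar

/-! For (i), m(t + B) = mt + mB, and mB is the scheme-theoretic image of B under a homomorphism,
which is again an abelian variety (`exists_grpObj_image`, `geometricallyIntegral_image`). The
inequalities are then arithmetic of orders.

For (ii), the Zariski topology on complex points is Noetherian, so some N is minimal among the
closed subgroups containing a positive multiple kp of p. Intersecting shows that N lies in every
such subgroup. One of them is kN, since multiplication by k is a closed map; hence kp = kq with q in
N, and p - q is killed by k. If mp lies in t + B, then B contains a positive multiple of p, so N ≤ B
and m(p - q) is a point of t + B killed by k. Thus k bounds all the orders. -/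

/-- If the multiples of `p` meet a coset `t + B` of a closed subgroup with `t` torsion, then the
coset contains a torsion point of order bounded in terms of `p` alone. -/
theorem exists_pos_forall_exists_nsmul_eq_zero {G : Type*} [AddCommGroup G]
    [TopologicalSpace G] [TopologicalSpace.NoetherianSpace G]
    (hmul : ∀ m : ℕ, 0 < m → IsClosedMap (fun x : G => m • x)) (p : G) :
    ∃ k : ℕ, 0 < k ∧ ∀ B : AddSubgroup G, IsClosed (B : Set G) → ∀ t : G, IsOfFinAddOrder t →
      ∀ m : ℕ, 0 < m → m • p - t ∈ B → ∃ s : G, s - t ∈ B ∧ k • s = 0 := by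
  let S : Set (TopologicalSpace.Closeds G) :=
    {Z | ∃ N : AddSubgroup G, (N : Set G) = Z ∧ ∃ k : ℕ, 0 < k ∧ k • p ∈ N}
  have hS : S.Nonempty := ⟨⊤, ⊤, by simp, 1, one_pos, AddSubgroup.mem_top _⟩
  obtain ⟨Z, ⟨N, hNZ, k, hk, hkp⟩, hmin⟩ := WellFounded.has_min
    (wellFounded_lt (α := TopologicalSpace.Closeds G)) S hS
  have hN : IsClosed (N : Set G) := hNZ ▸ Z.isClosed
  have key : ∀ B : AddSubgroup G, IsClosed (B : Set G) → ∀ n : ℕ, 0 < n → n • p ∈ B → N ≤ B := by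
    intro B hB n hn hnp
    by_contra hle
    refine hmin ⟨(N ⊓ B : AddSubgroup G), by simpa using hN.inter hB⟩
      ⟨N ⊓ B, rfl, n * k, Nat.mul_pos hn hk, ?_, ?_⟩ ?_
    · rw [mul_nsmul']; exact N.nsmul_mem hkp n
    · rw [mul_nsmul]; exact B.nsmul_mem hnp k
    · rw [← SetLike.coe_ssubset_coe, ← hNZ]
      change ((N ⊓ B : AddSubgroup G) : Set G) ⊂ N
      rw [SetLike.coe_ssubset_coe]
      exact inf_lt_left.mpr hle
  -- The closed subgroup kN contains k(kp) = k²p, so minimality gives N ≤ kN.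
  have hdiv : N ≤ N.map (nsmulAddMonoidHom k) :=
    key _ (by simpa using hmul k hk _ hN) (k * k) (Nat.mul_pos hk hk)
      ⟨k • p, hkp, by simp [mul_nsmul]⟩
  obtain ⟨q, hq, hqp⟩ := hdiv hkp
  replace hqp : k • q = k • p := hqp
  refine ⟨k, hk, fun B hB t ht m hm hmt => ⟨m • (p - q), ?_, ?_⟩⟩
  · have hNB : N ≤ B := by
      -- Multiplying mp - t ∈ B by the order of t removes t.
      refine key B hB (addOrderOf t * m) (Nat.mul_pos ht.addOrderOf_pos hm) ?_
      have := B.nsmul_mem hmt (addOrderOf t)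
      rwa [nsmul_sub, addOrderOf_nsmul_eq_zero, sub_zero, ← mul_nsmul'] at this
    have : m • (p - q) - t = (m • p - t) - m • q := by rw [nsmul_sub]; abel
    rw [this]
    exact B.sub_mem hmt (B.nsmul_mem (hNB hq) m)
  · rw [← mul_nsmul', mul_comm, mul_nsmul', nsmul_sub, hqp, sub_self, nsmul_zero]

/-! ### Group structures on subobjects -/

section

open CartesianMonoidalCategory MonObj

variable {𝒞 : Type*} [Category 𝒞] [CartesianMonoidalCategory 𝒞]

/-- The group structure on a subobject stable under the operations of a group object. -/
abbrev CategoryTheory.GrpObj.ofMono {C A : 𝒞} [GrpObj A] (i : C ⟶ A) [Mono i]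
    (e : 𝟙_ 𝒞 ⟶ C) (he : e ≫ i = η[A]) (m : C ⊗ C ⟶ C) (hm : m ≫ i = (i ⊗ₘ i) ≫ μ[A])
    (v : C ⟶ C) (hv : v ≫ i = i ≫ ι[A]) : GrpObj C where
  one := e
  mul := m
  inv := v
  one_mul := by
    rw [← cancel_mono i]
    have : (e ▷ C) ≫ (i ⊗ₘ i) = (𝟙_ 𝒞 ◁ i) ≫ (η[A] ▷ A) := by
      simp only [← tensorHom_id, ← id_tensorHom, tensorHom_comp_tensorHom, he, Category.id_comp,
        Category.comp_id]
    simp [hm, reassoc_of% this]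
  mul_one := by
    rw [← cancel_mono i]
    have : (C ◁ e) ≫ (i ⊗ₘ i) = (i ▷ 𝟙_ 𝒞) ≫ (A ◁ η[A]) := by
      simp only [← tensorHom_id, ← id_tensorHom, tensorHom_comp_tensorHom, he, Category.id_comp,
        Category.comp_id]
    simp [hm, reassoc_of% this]
  mul_assoc := by
    rw [← cancel_mono i]
    have h₁ : (m ▷ C) ≫ (i ⊗ₘ i) = ((i ⊗ₘ i) ⊗ₘ i) ≫ (μ[A] ▷ A) := by
      simp only [← tensorHom_id, tensorHom_comp_tensorHom, hm, Category.id_comp, Category.comp_id]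
    have h₂ : (C ◁ m) ≫ (i ⊗ₘ i) = (i ⊗ₘ (i ⊗ₘ i)) ≫ (A ◁ μ[A]) := by
      simp only [← id_tensorHom, tensorHom_comp_tensorHom, hm, Category.id_comp, Category.comp_id]
    simp [hm, reassoc_of% h₁, reassoc_of% h₂]
  left_inv := by
    rw [← cancel_mono i]
    have : lift v (𝟙 C) ≫ (i ⊗ₘ i) = i ≫ lift ι[A] (𝟙 A) := by ext <;> simp [hv]
    simp [hm, he, reassoc_of% this]
  right_inv := by
    rw [← cancel_mono i]
    have : lift (𝟙 C) v ≫ (i ⊗ₘ i) = i ≫ lift (𝟙 A) ι[A] := by ext <;> simp [hv]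
    simp [hm, he, reassoc_of% this]

end

/-! ### Scheme-theoretic dominance and geometric integrality -/

namespace AlgebraicGeometry

/-- Scheme-theoretically dominant morphisms lift against closed immersions. -/
theorem IsSchemeTheoreticallyDominant.exists_lift {X Y Z W : Scheme} (q : X ⟶ Y)
    [IsSchemeTheoreticallyDominant q] (g : Y ⟶ Z) (i : W ⟶ Z) [IsClosedImmersion i] (h : X ⟶ W)
    (w : q ≫ g = h ≫ i) : ∃ l : Y ⟶ W, l ≫ i = g := by
  have hk : i.ker ≤ g.ker := by
    have := h.le_ker_comp i
    rwa [← w, Scheme.Hom.ker_comp, q.ker_eq_bot, Scheme.IdealSheafData.map_bot] at this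
  exact ⟨IsClosedImmersion.lift i g hk, IsClosedImmersion.lift_fac _ _ _⟩

instance isSchemeTheoreticallyDominant_toImage {X Y : Scheme} (f : X ⟶ Y) [QuasiCompact f] :
    IsSchemeTheoreticallyDominant f.toImage where
  ker_eq_bot := by
    refine Scheme.IdealSheafData.ext_of_iSup_eq_top
      (fun U : Y.affineOpens => ⟨f.imageι ⁻¹ᵁ U, U.2.preimage _⟩)
      (Y.isBasis_affineOpens.isOpenCover.comap f.imageι.base.hom) fun U => ?_
    rw [Scheme.Hom.ker_apply, (RingHom.injective_iff_ker_eq_bot _).mp (f.toImage_app_injective U)]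
    rfl

theorem IsSchemeTheoreticallyDominant.isIntegral {X Y : Scheme} (f : X ⟶ Y)
    [IsSchemeTheoreticallyDominant f] [QuasiCompact f] [IsIntegral X] : IsIntegral Y := by
  rw [isIntegral_iff_irreducibleSpace_and_isReduced]
  have : PreirreducibleSpace Y := ⟨by
    rw [← f.denseRange.closure_range, ← Set.image_univ]
    exact ((IrreducibleSpace.isIrreducible_univ X).image _
      f.continuous.continuousOn).isPreirreducible.closure⟩
  exact ⟨⟨Nonempty.map f inferInstance⟩, isReduced f⟩

/-- The target of a scheme-theoretically dominant morphism from a geometrically integral scheme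
over a field is geometrically integral. -/
theorem GeometricallyIntegral.of_isSchemeTheoreticallyDominant {K : Type} [Field K] {X Y : Scheme}
    (f : X ⟶ Y) (g : Y ⟶ Spec (.of K)) [IsSchemeTheoreticallyDominant f] [QuasiCompact f]
    [GeometricallyIntegral (f ≫ g)] : GeometricallyIntegral g := by
  refine ⟨fun L _ y Z fst snd h => ?_⟩
  -- Scheme-theoretic dominance of a quasi-compact morphism survives flat base change, here along a
  -- field extension.
  have : Flat fst := MorphismProperty.of_isPullback h.flip (inferInstance : Flat y)
  have := IsSchemeTheoreticallyDominant.pullbackFst fst f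
  have : IsIntegral (Limits.pullback fst f) :=
    GeometricallyIntegral.geometrically_isIntegral (f := f ≫ g) y _ _
      ((IsPullback.of_hasPullback fst f).flip.paste_vert h)
  exact IsSchemeTheoreticallyDominant.isIntegral (Limits.pullback.fst fst f)

end AlgebraicGeometry

/-! ### Powers of homomorphisms into commutative group objects -/

section

open CartesianMonoidalCategory MonObj

theorem CategoryTheory.IsMonHom.pow {𝒞 : Type*} [Category 𝒞] [CartesianMonoidalCategory 𝒞]
    [BraidedCategory 𝒞] {M N : 𝒞} [MonObj M] [MonObj N] [IsCommMonObj N] (f : M ⟶ N) [IsMonHom f]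
    (n : ℕ) : IsMonHom (f ^ n) where
  one_hom := by rw [comp_pow, IsMonHom.one_hom, one_eq_one, one_pow]
  mul_hom := by
    have h (g : M ⟶ N) : (g ⊗ₘ g) ≫ μ[N] = (fst M M ≫ g) * (snd M M ≫ g) := by
      rw [Hom.mul_def]; congr 1; ext <;> simp
    rw [comp_pow, IsMonHom.mul_hom, h, h, comp_pow, comp_pow, mul_pow]

end

/-! ### Complex points and their Zariski topology -/

namespace AbVar

/-- The closed point of a scheme over `ℂ` underlying a complex point. -/
noncomputable def Points.toPoint {X : SchC} (x : Points X) : X.left :=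
  x.toMul.left (IsLocalRing.closedPoint ℂ : Spec (.of ℂ))

theorem Points.toPoint_map {X Y : SchC} (f : X ⟶ Y) (x : Points X) :
    (Points.map f x).toPoint = f.left x.toPoint := by
  simp only [Points.map, Points.toPoint, toMul_ofMul, Over.comp_left]
  exact Scheme.Hom.comp_apply _ _ _

theorem Points.toPoint_injective (X : SchC) [LocallyOfFiniteType X.hom] :
    Function.Injective (Points.toPoint (X := X)) := by
  intro x y h
  refine Additive.toMul.injective (Over.OverMorphism.ext ?_)
  exact ext_of_apply_closedPoint_eq X.hom (Over.w x.toMul) (Over.w y.toMul) h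

theorem Points.exists_toPoint_eq {X : SchC} [LocallyOfFiniteType X.hom] {x : X.left}
    (hx : IsClosed {x}) : ∃ y : Points X, y.toPoint = x :=
  ⟨Additive.ofMul (Over.homMk (pointOfClosedPoint X.hom x hx) (pointOfClosedPoint_comp _ _ _)),
    pointOfClosedPoint_apply _ _ _ _⟩

theorem Points.isClosed_toPoint {X : SchC} [LocallyOfFiniteType X.hom] (x : Points X) :
    IsClosed {x.toPoint} :=
  (pointEquivClosedPoint X.hom ⟨x.toMul.left, Over.w x.toMul⟩).2

/-- A complex point in the image of a closed subset lifts to a complex point of it. -/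
theorem Points.exists_map_eq {X Y : SchC} [LocallyOfFiniteType X.hom] [LocallyOfFiniteType Y.hom]
    (f : X ⟶ Y) {Z : Set X.left} (hZ : IsClosed Z) {y : Points Y} (hy : y.toPoint ∈ f.left '' Z) :
    ∃ x : Points X, x.toPoint ∈ Z ∧ Points.map f x = y := by
  have : JacobsonSpace X.left := LocallyOfFiniteType.jacobsonSpace (Y := Spec (.of ℂ)) X.hom
  obtain ⟨z, hz, hzy⟩ := hy
  have hcl : IsClosed (Z ∩ f.left ⁻¹' {y.toPoint}) :=
    hZ.inter (y.isClosed_toPoint.preimage f.left.continuous)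
  have hne : (Z ∩ f.left ⁻¹' {y.toPoint}).Nonempty := ⟨z, hz, hzy⟩
  -- In a Jacobson space the nonempty closed set `Z ∩ f⁻¹(y)` contains a closed point, which is a
  -- complex point.
  obtain ⟨w, ⟨hwZ, hwy⟩, hw⟩ := nonempty_inter_closedPoints hne hcl.isLocallyClosed
  obtain ⟨x, rfl⟩ := exists_toPoint_eq hw
  exact ⟨x, hwZ, toPoint_injective Y (by rw [toPoint_map]; exact hwy)⟩

/-- The Zariski topology on the complex points. -/
noncomputable abbrev Points.zariski (X : SchC) : TopologicalSpace (Points X) :=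
  .induced Points.toPoint inferInstance

theorem Points.noetherianSpace (X : SchC) [LocallyOfFiniteType X.hom] [QuasiCompact X.hom] :
    letI := Points.zariski X
    TopologicalSpace.NoetherianSpace (Points X) := by
  let := Points.zariski X
  have : CompactSpace X.left := (quasiCompact_iff_compactSpace X.hom).mp inferInstance
  have : IsNoetherian X.left := { __ := LocallyOfFiniteType.isLocallyNoetherian X.hom }
  exact Topology.IsInducing.noetherianSpace (i := Points.toPoint) ⟨rfl⟩

theorem Points.isClosedMap_map {X Y : SchC} [IsProper X.hom] [IsProper Y.hom] (f : X ⟶ Y) :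
    letI := Points.zariski X
    letI := Points.zariski Y
    IsClosedMap (Points.map f) := by
  let := Points.zariski X
  let := Points.zariski Y
  intro S hS
  obtain ⟨Z, hZ, rfl⟩ := isClosed_induced_iff.mp hS
  have : IsProper (f.left ≫ Y.hom) := by rw [Over.w]; infer_instance
  have : IsProper f.left := .of_comp _ Y.hom
  refine isClosed_induced_iff.mpr ⟨f.left '' Z, f.left.isClosedMap _ hZ, ?_⟩
  ext y
  refine ⟨fun hy => exists_map_eq f hZ hy, ?_⟩
  rintro ⟨x, hx, rfl⟩
  exact ⟨x.toPoint, hx, (toPoint_map f x).symm⟩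

/-! ### Images of homomorphisms of abelian varieties -/

section image

variable {B A : SchC} (f : B ⟶ A)

/-- The scheme-theoretic image of a morphism over `ℂ`. -/
noncomputable abbrev image : SchC := Over.mk (f.left.imageι ≫ A.hom)

noncomputable abbrev toImage : B ⟶ image f := Over.homMk f.left.toImage (by simp)

noncomputable abbrev imageι : image f ⟶ A := Over.homMk f.left.imageι rfl

theorem toImage_imageι : toImage f ≫ imageι f = f := by ext1; simp

variable [IsProper A.hom]

theorem isProper_image : IsProper (image f).hom :=
  inferInstanceAs (IsProper (f.left.imageι ≫ A.hom))

variable [IsProper B.hom]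

theorem isProper_left : IsProper f.left :=
  have : IsProper (f.left ≫ A.hom) := by rw [Over.w]; infer_instance
  .of_comp _ A.hom

theorem surjective_toImage : Surjective f.left.toImage := by
  have := isProper_left f
  exact surjective_of_isDominant_of_isClosed_range _ f.left.toImage.isClosedMap.isClosed_range

theorem geometricallyIntegral_image [GeometricallyIntegral B.hom] :
    GeometricallyIntegral (image f).hom := by
  have := isProper_left f
  have : GeometricallyIntegral (f.left.toImage ≫ (image f).hom) := by simpa
  exact .of_isSchemeTheoreticallyDominant f.left.toImage _

theorem range_map_imageι : Set.range (Points.map (imageι f)) = Set.range (Points.map f) := by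
  have := isProper_left f
  have := isProper_image f
  ext x
  constructor
  · rintro ⟨y, rfl⟩
    have hs : y.toPoint ∈ (toImage f).left '' Set.univ := by
      obtain ⟨b, hb⟩ := (surjective_toImage f).surj y.toPoint
      exact ⟨b, trivial, hb⟩
    obtain ⟨b, -, rfl⟩ := Points.exists_map_eq (toImage f) isClosed_univ hs
    refine ⟨b, ?_⟩
    conv_lhs => rw [← toImage_imageι f]
    simp [Points.map]
  · rintro ⟨b, rfl⟩
    refine ⟨Points.map (toImage f) b, ?_⟩
    conv_rhs => rw [← toImage_imageι f]
    simp [Points.map]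

open MonObj

/-- A dominant morphism to a reduced scheme is scheme-theoretically dominant. The self-product of
the image is reduced because the image is geometrically integral. -/
theorem isSchemeTheoreticallyDominant_toImage_tensorHom [GeometricallyIntegral B.hom] :
    IsSchemeTheoreticallyDominant (toImage f ⊗ₘ toImage f).left := by
  have := isProper_image f
  have := geometricallyIntegral_image f
  have := surjective_toImage f
  have : IsIntegral (image f).left :=
    GeometricallyIntegral.isIntegral_of_subsingleton (S := Spec (.of ℂ)) (image f).hom
  have : IsLocallyNoetherian (image f).left :=
    LocallyOfFiniteType.isLocallyNoetherian (Y := Spec (.of ℂ)) (image f).hom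
  have : IsReduced (image f ⊗ image f).left :=
    inferInstanceAs (IsReduced (Limits.pullback (image f).hom (image f).hom))
  have : Surjective (toImage f ⊗ₘ toImage f).left := by
    refine ⟨Set.range_eq_univ.mp ?_⟩
    rw [Over.tensorHom_left, Scheme.Pullback.range_map]
    simp [Set.range_eq_univ.mpr f.left.toImage.surjective]
  exact .of_isDominant _

/-- The operations of `A`, restricted to the image, factor through it after composing with the
scheme-theoretically dominant maps from `B` and `B ⊗ B`; hence they already factor through the
closed immersion. -/
theorem exists_grpObj_image [GeometricallyIntegral B.hom] [GrpObj B] [GrpObj A]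
    [IsMonHom f] :
    ∃ _ : GrpObj (image f), IsMonHom (imageι f) := by
  have := isProper_left f
  have hd : IsSchemeTheoreticallyDominant (toImage f).left :=
    inferInstanceAs (IsSchemeTheoreticallyDominant f.left.toImage)
  have hcl : IsClosedImmersion (imageι f).left :=
    inferInstanceAs (IsClosedImmersion f.left.imageι)
  have : Mono (imageι f) := Over.mono_of_mono_left _
  have lifts {X Y : SchC} (q : X ⟶ Y) [IsSchemeTheoreticallyDominant q.left] (g : Y ⟶ A)
      (h : X ⟶ image f) (w : q ≫ g = h ≫ imageι f) : ∃ l : Y ⟶ image f, l ≫ imageι f = g := by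
    obtain ⟨l, hl⟩ := IsSchemeTheoreticallyDominant.exists_lift q.left g.left (imageι f).left h.left
      (congrArg CommaMorphism.left w)
    exact ⟨Over.homMk l (by rw [← Over.w g, ← hl, Category.assoc]; rfl), by ext1; exact hl⟩
  have := isSchemeTheoreticallyDominant_toImage_tensorHom f
  obtain ⟨m, hm⟩ := lifts (toImage f ⊗ₘ toImage f) ((imageι f ⊗ₘ imageι f) ≫ μ[A])
    (μ[B] ≫ toImage f) (by
      rw [Category.assoc, toImage_imageι, IsMonHom.mul_hom, tensorHom_comp_tensorHom_assoc,
        toImage_imageι])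
  obtain ⟨v, hv⟩ := lifts (toImage f) (imageι f ≫ ι[A]) (ι[B] ≫ toImage f) (by
    rw [Category.assoc, toImage_imageι, ← Category.assoc, toImage_imageι, GrpObj.inv_hom])
  have he : (η[B] ≫ toImage f) ≫ imageι f = η[A] := by
    rw [Category.assoc, toImage_imageι, IsMonHom.one_hom]
  let := GrpObj.ofMono (imageι f) _ he m hm v hv
  exact ⟨this, { one_hom := he, mul_hom := hm }⟩

end image

end AbVar

/-! ### Torsion translates and their orders -/

namespace AbVar

variable {A : SchC} [GrpObj A] [IsAbelianVariety A]

variable (A) in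
theorem isCommMonObj : IsCommMonObj A :=
  have : IsProper A.hom := IsAbelianVariety.isProper
  have : GeometricallyIntegral A.hom := IsAbelianVariety.geometricallyIntegral
  isCommMonObj_of_isProper_of_geometricallyIntegral A

open MonObj in
/-- The `m`-th multiple of a morphism into a group scheme, for the pointwise group law. -/
noncomputable def nsmulHom {B G : SchC} [GrpObj G] (m : ℕ) (f : B ⟶ G) : B ⟶ G := f ^ m

theorem isMonHom_nsmulHom {B : SchC} [GrpObj B] (m : ℕ) (f : B ⟶ A) [IsMonHom f] :
    IsMonHom (nsmulHom m f) :=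
  have := isCommMonObj A
  .pow f m

theorem Points.map_nsmulHom {B : SchC} (m : ℕ) (f : B ⟶ A) (b : Points B) :
    Points.map (nsmulHom m f) b = m • Points.map f b :=
  congrArg Additive.ofMul (MonObj.comp_pow f m b.toMul)

theorem Points.map_id {X : SchC} (x : Points X) : Points.map (𝟙 X) x = x :=
  congrArg Additive.ofMul (Category.comp_id x.toMul)

theorem Points.isClosedMap_nsmul (m : ℕ) :
    letI := Points.zariski A
    IsClosedMap (fun x : Points A => m • x) := by
  have : IsProper A.hom := IsAbelianVariety.isProper
  have h : (fun x : Points A => m • x) = Points.map (nsmulHom m (𝟙 A)) := by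
    funext x
    rw [map_nsmulHom, map_id]
  rw [h]
  exact isClosedMap_map _

/-- The complex points of an abelian subvariety form a subgroup. -/
theorem IsAbelianSubvariety.exists_addSubgroup {H : Set (Points A)} (hH : IsAbelianSubvariety A H) :
    ∃ N : AddSubgroup (Points A), (N : Set (Points A)) = H := by
  obtain ⟨B, _, i, _, _, _, rfl⟩ := hH
  let φ : Points B →+ Points A :=
    { toFun := Points.map i
      map_zero' := congrArg Additive.ofMul (MonObj.one_comp i)
      map_add' := fun x y => congrArg Additive.ofMul (MonObj.mul_comp x.toMul y.toMul i) }
  exact ⟨φ.range, φ.coe_range⟩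

theorem IsAbelianSubvariety.isClosed {H : Set (Points A)} (hH : IsAbelianSubvariety A H) :
    letI := Points.zariski A
    IsClosed H := by
  obtain ⟨B, _, i, _, _, _, rfl⟩ := hH
  have : IsProper A.hom := IsAbelianVariety.isProper
  have : IsProper B.hom := IsAbelianVariety.isProper
  let := Points.zariski B
  let := Points.zariski A
  exact (Points.isClosedMap_map i).isClosed_range

/-- The image of an abelian subvariety under multiplication by `m` is an abelian subvariety. -/
theorem IsAbelianSubvariety.mulImage {H : Set (Points A)} (hH : IsAbelianSubvariety A H) (m : ℕ) :
    IsAbelianSubvariety A (mulImage m H) := by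
  obtain ⟨B, _, i, _, _, _, rfl⟩ := hH
  have : IsProper A.hom := IsAbelianVariety.isProper
  have : IsProper B.hom := IsAbelianVariety.isProper
  have : GeometricallyIntegral B.hom := IsAbelianVariety.geometricallyIntegral
  have := isMonHom_nsmulHom m i
  obtain ⟨hG, hι⟩ := exists_grpObj_image (nsmulHom m i)
  refine ⟨image (nsmulHom m i), hG, imageι (nsmulHom m i), ⟨isProper_image _, geometricallyIntegral_image _⟩, hι,
    inferInstanceAs (IsClosedImmersion (nsmulHom m i).left.imageι), ?_⟩
  rw [range_map_imageι, AbVar.mulImage, ← Set.range_comp]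
  exact congrArg Set.range (funext fun b => (Points.map_nsmulHom m i b).symm)

theorem mulImage_mem_torsionTranslates {T : Set (Points A)} (hT : T ∈ torsionTranslates A)
    (m : ℕ) : mulImage m T ∈ torsionTranslates A := by
  obtain ⟨H, t, hH, ht, rfl⟩ := hT
  refine ⟨mulImage m H, m • t, hH.mulImage m, ht.nsmul, ?_⟩
  simp only [mulImage, Set.image_image, nsmul_add]

theorem ord_le {T : Set (Points A)} {t : Points A} (ht : t ∈ T) {n : ℕ} (hn : 0 < n)
    (h : n • t = 0) : ord T ≤ n := by
  refine le_trans (Nat.sInf_le ?_) (addOrderOf_le_of_nsmul_eq_zero hn h)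
  exact ⟨t, ht, isOfFinAddOrder_iff_nsmul_eq_zero.mpr ⟨n, hn, h⟩, rfl⟩

theorem exists_addOrderOf_eq_ord {T : Set (Points A)} (hT : T ∈ torsionTranslates A) :
    ∃ t ∈ T, IsOfFinAddOrder t ∧ addOrderOf t = ord T := by
  obtain ⟨H, t, hH, ht, rfl⟩ := hT
  obtain ⟨N, rfl⟩ := hH.exists_addSubgroup
  -- The set contains the order of `t`, so the infimum is attained and is not the default value 0.
  obtain ⟨s, hs, hs', h⟩ := Nat.sInf_mem
    (s := {n | ∃ s ∈ (fun h => t + h) '' (N : Set (Points A)), IsOfFinAddOrder s ∧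
      n = addOrderOf s})
    ⟨_, t, ⟨0, N.zero_mem, add_zero t⟩, ht, rfl⟩
  exact ⟨s, hs, hs', h.symm⟩

theorem ord_mulImage_le {T : Set (Points A)} (hT : T ∈ torsionTranslates A) (m : ℕ) :
    ord (mulImage m T) ≤ ord T := by
  obtain ⟨t, htT, ht, h⟩ := exists_addOrderOf_eq_ord hT
  refine ord_le (Set.mem_image_of_mem _ htT) (h ▸ ht.addOrderOf_pos) ?_
  rw [nsmul_left_comm, ← h, addOrderOf_nsmul_eq_zero, nsmul_zero]

/-- A torsion point of least order in mT is mx with x in T, and x is killed by m times that order.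
-/
theorem ord_le_mul_ord_mulImage {T : Set (Points A)} (hT : T ∈ torsionTranslates A) {m : ℕ}
    (hm : 0 < m) : ord T ≤ m * ord (mulImage m T) := by
  obtain ⟨_, ⟨x, hx, rfl⟩, ht, h⟩ :=
    exists_addOrderOf_eq_ord (mulImage_mem_torsionTranslates hT m)
  refine ord_le hx (Nat.mul_pos hm (h ▸ ht.addOrderOf_pos)) ?_
  rw [mul_nsmul, ← h, addOrderOf_nsmul_eq_zero]

theorem bddAbove_ord (p : Points A) :
    BddAbove {n : ℕ | ∃ T ∈ torsionTranslates A, (∃ m : ℕ, 0 < m ∧ m • p ∈ T) ∧ n = ord T} := by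
  have : IsProper A.hom := IsAbelianVariety.isProper
  let := Points.zariski A
  have := Points.noetherianSpace A
  obtain ⟨k, hk, h⟩ := exists_pos_forall_exists_nsmul_eq_zero
    (fun m _ => Points.isClosedMap_nsmul m) p
  refine ⟨k, ?_⟩
  rintro _ ⟨_, ⟨H, t, hH, ht, rfl⟩, ⟨m, hm, x, hx, hxp⟩, rfl⟩
  obtain ⟨N, rfl⟩ := hH.exists_addSubgroup
  obtain ⟨s, hs, hks⟩ := h N hH.isClosed t ht m hm (by
    rw [← hxp]; simpa using hx)
  refine ord_le (t := s) ?_ hk hks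
  exact ⟨s - t, hs, add_sub_cancel t s⟩

end AbVar

theorem lemma3p9 (A : AbVar.SchC) [GrpObj A] [AbVar.IsAbelianVariety A] :
    (∀ T ∈ AbVar.torsionTranslates A, ∀ m : ℕ, 0 < m →
      AbVar.mulImage m T ∈ AbVar.torsionTranslates A ∧
        AbVar.ord (AbVar.mulImage m T) ≤ AbVar.ord T ∧ AbVar.ord T ≤ m * AbVar.ord (AbVar.mulImage m T)) ∧
    (∀ p : AbVar.Points A,
      BddAbove {n : ℕ | ∃ T ∈ AbVar.torsionTranslates A,
        (∃ m : ℕ, 0 < m ∧ m • p ∈ T) ∧ n = AbVar.ord T}) :=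
  ⟨fun _ hT m hm => ⟨AbVar.mulImage_mem_torsionTranslates hT m, AbVar.ord_mulImage_le hT m,
    AbVar.ord_le_mul_ord_mulImage hT hm⟩, AbVar.bddAbove_ord⟩
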